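/- **Syntax.** Let $\mathcal A$ be a set of actions, $\mathcal R=\mathbb R_{>0}$ the set of rates and $\mathcal K$ an infinite set of communication keys. Standard forward processes are generated by $P,Q ::= \underline 0 \mid \langle a,\lambda\rangle.P \mid P+Q \mid P\parallel_L Q$, and reversible processes by $R,S ::= P \mid \langle a,\lambda\rangle[i].R \mid R+S \mid R\parallel_L S$, where $a\in\mathcal A$, $\lambda\in\mathcal R$, $i\in\mathcal K$, $L\subseteq\mathcal A$. Write $\mathrm{std}(R)$ if $R$ is a standard forward process and $\mathrm{key}(R)$ for the set of keys occurring in $R$. Let $(a,\lambda)\mapsto\bar\lambda\in\mathcal R$ be an arbitrary assignment of backward rates. **Transitions.** Forward transitions $R\xrightarrow{\langle a,\lambda\rangle[i]}R'$ are the least relations such that (up to the symmetric variants of choice and of asynchronous parallel composition): - $\langle a,\lambda\rangle.R\xrightarrow{\langle a,\lambda\rangle[i]}\langle a,\lambda\rangle[i].R$ if $\mathrm{std}(R)$; - $\langle a,\lambda\rangle[i].R\xrightarrow{\langle b,\mu\rangle[j]}\langle a,\lambda\rangle[i].R'$ if $R\xrightarrow{\langle b,\mu\rangle[j]}R'$ and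 $j\ne i$; - $R+S\xrightarrow{\langle a,\lambda\rangle[i]}R'+S$ if $R\xrightarrow{\langle a,\lambda\rangle[i]}R'$ and $\mathrm{std}(S)$; - $R\parallel_L S\xrightarrow{\langle a,\lambda\rangle[i]}R'\parallel_L S$ if $R\xrightarrow{\langle a,\lambda\rangle[i]}R'$, $a\notin L$ and $i\notin\mathrm{key}(S)$; - $R\parallel_L S\xrightarrow{\langle a,\lambda\cdot\mu\rangle[i]}R'\parallel_L S'$ if $R\xrightarrow{\langle a,\lambda\rangle[i]}R'$, $S\xrightarrow{\langle a,\mu\rangle[i]}S'$ and $a\in L$. Backward transitions are defined by the same rules, except that the first one is replaced by: $\langle a,\lambda\rangle[i].R$ has a backward transition to $\langle a,\lambda\rangle.R$ with label $\langle a,\bar\lambda\rangle[i]$ if $\mathrm{std}(R)$; rates of synchronizing backward transitions are multiplied too. A process is *reachable* if it is obtained from a standard forward process by finitely many forward transitions; let $\mathbb P$ be the set of reachable processes. **Underlying CTMC.** Let $\equiv_{\mathcal K}$ be the smallest equivalence relation on $\mathbb P$ that relates a process to the one obtained by replacing all occurrences of a key $i$ by a key $j$ that does not occur in the process. For $R\in\mathbb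 P$, let $\mathcal M[\![R]\!]$ be the Markov chain whose transitions are obtained from the forward and backward transitions by passing to $\equiv_{\mathcal K}$-classes and forgetting the keys in the labels (so there is a transition from $c$ to $c'$ labelled with action $a$ and rate $r$ iff some member of $c$ has a forward or backward transition with action $a$ and rate $r$ to some member of $c'$), and whose states are the classes that can be reached from the class of $R$. Its rate $q_{s,s'}$, for $s\ne s'$, is the sum of the rates of the transitions from $s$ to $s'$; its generator $Q$ has off-diagonal entries $q_{s,s'}$ and rows summing to $0$. **Statement.** Let $\mathbb P'\subseteq\mathbb P$ be the set of reachable processes in which parallel composition never occurs inside the scope of an action prefix (executed or not) or of a choice. Then for every $R\in\mathbb P'$, and with no constraint on the backward rates, $\mathcal M[\![R]\!]$ is time reversible. That is: $\mathcal M[\![R]\!]$ has finitely many states; there is a unique $\pi$ with $\pi(s)>0$ for all $s$, $\sum_s\pi(s)=1$ and $\pi Q=0$; it satisfies the partial balance equations $\pi(s)\,q_{s,s'}=\pi(s')\,q_{s',s}$ for all $s\ne s'$; and every stationary time-homogeneous continuous-time Markov chain $(X(t))_{t\ge0}$ with generator $Q$ (that is, with transition probabilities $\Pr\{X(t+h)=s'\mid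 X(t)=s\}=(e^{hQ})_{s,s'}$) is time reversible, i.e. $(X(t_1),\dots,X(t_n))$ and $(X(t'-t_1),\dots,X(t'-t_n))$ have the same joint distribution for all $n$, all $0\le t_1<\dots<t_n$ and all $t'\ge t_n$. -/

import Mathlib

open scoped NNReal
open MeasureTheory ProbabilityTheory

universe u v w

namespace RMPC

/-- Rates are positive real numbers. -/
abbrev Rate : Type := {r : ℝ // 0 < r}

/-! ### The process calculus -/

/-- Process terms over actions `Act` and communication keys `Key`:
`nil` is the terminated process, `pre a lam R` is the unexecuted prefix `<a,lam>.R`,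
`past a lam i R` is the executed prefix `<a,lam>[i].R`, `choice R S` is `R + S`, and
`par L R S` is the parallel composition of `R` and `S` with synchronization set `L`. -/
inductive Proc (Act : Type u) (Key : Type v) : Type (max u v)
  | nil : Proc Act Key
  | pre : Act → Rate → Proc Act Key → Proc Act Key
  | past : Act → Rate → Key → Proc Act Key → Proc Act Key
  | choice : Proc Act Key → Proc Act Key → Proc Act Key
  | par : Set Act → Proc Act Key → Proc Act Key → Proc Act Key

namespace Proc

variable {Act : Type u} {Key : Type v}

/-- Standard forward processes: no prefix has been executed. -/
def Std : Proc Act Key → Prop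
  | nil => True
  | pre _ _ R => R.Std
  | past _ _ _ _ => False
  | choice R S => R.Std ∧ S.Std
  | par _ R S => R.Std ∧ S.Std

/-- The set of communication keys that occur in a process. -/
def keys : Proc Act Key → Set Key
  | nil => ∅
  | pre _ _ R => R.keys
  | past _ _ i R => {i} ∪ R.keys
  | choice R S => R.keys ∪ S.keys
  | par _ R S => R.keys ∪ S.keys

open Classical in
/-- Replace every occurrence of the key `i` by the key `j`. -/
noncomputable def rekey (i j : Key) : Proc Act Key → Proc Act Key
  | nil => nil
  | pre a lam R => pre a lam (R.rekey i j)
  | past a lam k R => past a lam (if k = i then j else k) (R.rekey i j)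
  | choice R S => choice (R.rekey i j) (S.rekey i j)
  | par L R S => par L (R.rekey i j) (S.rekey i j)

/-- Sequential processes: parallel composition does not occur. -/
def Sequential : Proc Act Key → Prop
  | nil => True
  | pre _ _ R => R.Sequential
  | past _ _ _ R => R.Sequential
  | choice R S => R.Sequential ∧ S.Sequential
  | par _ _ _ => False

/-- Parallel composition does not occur inside the scope of a prefix (executed or not) or of a
choice. -/
def ParOutermost : Proc Act Key → Prop
  | nil => True
  | pre _ _ R => R.Sequential
  | past _ _ _ R => R.Sequential
  | choice R S => R.Sequential ∧ S.Sequential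
  | par _ R S => R.ParOutermost ∧ S.ParOutermost

end Proc

section Semantics

variable {Act : Type u} {Key : Type v}

/-- `Fwd R a lam i R'` is the forward transition from `R` to `R'` labelled `<a,lam>[i]`. -/
inductive Fwd : Proc Act Key → Act → Rate → Key → Proc Act Key → Prop
  | act1 {a : Act} {lam : Rate} {i : Key} {R : Proc Act Key} :
      R.Std → Fwd (.pre a lam R) a lam i (.past a lam i R)
  | act2 {a b : Act} {lam mu : Rate} {i j : Key} {R R' : Proc Act Key} :
      Fwd R b mu j R' → j ≠ i → Fwd (.past a lam i R) b mu j (.past a lam i R')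
  | choL {a : Act} {lam : Rate} {i : Key} {R R' S : Proc Act Key} :
      Fwd R a lam i R' → S.Std → Fwd (.choice R S) a lam i (.choice R' S)
  | choR {a : Act} {lam : Rate} {i : Key} {R S S' : Proc Act Key} :
      Fwd S a lam i S' → R.Std → Fwd (.choice R S) a lam i (.choice R S')
  | parL {a : Act} {lam : Rate} {i : Key} {L : Set Act} {R R' S : Proc Act Key} :
      Fwd R a lam i R' → a ∉ L → i ∉ S.keys → Fwd (.par L R S) a lam i (.par L R' S)
  | parR {a : Act} {lam : Rate} {i : Key} {L : Set Act} {R S S' : Proc Act Key} :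
      Fwd S a lam i S' → a ∉ L → i ∉ R.keys → Fwd (.par L R S) a lam i (.par L R S')
  | coo {a : Act} {lam mu : Rate} {i : Key} {L : Set Act} {R R' S S' : Proc Act Key} :
      Fwd R a lam i R' → Fwd S a mu i S' → a ∈ L →
      Fwd (.par L R S) a (lam * mu) i (.par L R' S')

/-- `Bwd bar R a r i R'` is the backward transition from `R` to `R'` that undoes the action `a`
with key `i` at rate `r`, where `bar a lam` is the rate at which an executed prefix `<a,lam>[i]`
is undone. -/
inductive Bwd (bar : Act → Rate → Rate) :
    Proc Act Key → Act → Rate → Key → Proc Act Key → Prop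
  | act1 {a : Act} {lam : Rate} {i : Key} {R : Proc Act Key} :
      R.Std → Bwd bar (.past a lam i R) a (bar a lam) i (.pre a lam R)
  | act2 {a b : Act} {lam r : Rate} {i j : Key} {R R' : Proc Act Key} :
      Bwd bar R b r j R' → j ≠ i → Bwd bar (.past a lam i R) b r j (.past a lam i R')
  | choL {a : Act} {r : Rate} {i : Key} {R R' S : Proc Act Key} :
      Bwd bar R a r i R' → S.Std → Bwd bar (.choice R S) a r i (.choice R' S)
  | choR {a : Act} {r : Rate} {i : Key} {R S S' : Proc Act Key} :
      Bwd bar S a r i S' → R.Std → Bwd bar (.choice R S) a r i (.choice R S')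
  | parL {a : Act} {r : Rate} {i : Key} {L : Set Act} {R R' S : Proc Act Key} :
      Bwd bar R a r i R' → a ∉ L → i ∉ S.keys → Bwd bar (.par L R S) a r i (.par L R' S)
  | parR {a : Act} {r : Rate} {i : Key} {L : Set Act} {R S S' : Proc Act Key} :
      Bwd bar S a r i S' → a ∉ L → i ∉ R.keys → Bwd bar (.par L R S) a r i (.par L R S')
  | coo {a : Act} {r r' : Rate} {i : Key} {L : Set Act} {R R' S S' : Proc Act Key} :
      Bwd bar R a r i R' → Bwd bar S a r' i S' → a ∈ L →
      Bwd bar (.par L R S) a (r * r') i (.par L R' S')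

/-- Reachable processes: those obtained from a standard process by finitely many forward
transitions. In such a process, all occurrences of a key stem from one and the same (possibly
synchronized) execution of an action. -/
def Reachable (R : Proc Act Key) : Prop :=
  ∃ P : Proc Act Key, P.Std ∧
    Relation.ReflTransGen (fun S S' => ∃ a lam i, Fwd S a lam i S') P R

end Semantics

/-! ### The underlying continuous-time Markov chain -/

section Chain

variable (Act : Type u) (Key : Type v)

/-- The set of reachable processes. -/
abbrev RProc : Type (max u v) := {R : Proc Act Key // Reachable R}

/-- The smallest equivalence relation on reachable processes that relates a process to the one
obtained by replacing a key, in all the prefixes synchronized through it, by a key that does not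
occur in the process. -/
def keyEquiv : Setoid (RProc Act Key) :=
  Relation.EqvGen.setoid fun R R' => ∃ i j, j ∉ R.1.keys ∧ R'.1 = R.1.rekey i j

/-- Classes of reachable processes that are identical up to a renaming of keys. -/
abbrev Cls : Type (max u v) := Quotient (keyEquiv Act Key)

variable {Act Key}

/-- The transition relation on classes: the union of the forward and of the backward transitions,
with keys removed from the labels. -/
def Trans (bar : Act → Rate → Rate) (c : Cls Act Key) (l : Act × Rate) (c' : Cls Act Key) :
    Prop :=
  ∃ S S' : RProc Act Key, c = Quotient.mk _ S ∧ c' = Quotient.mk _ S' ∧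
    ∃ i, Fwd S.1 l.1 l.2 i S'.1 ∨ Bwd bar S.1 l.1 l.2 i S'.1

/-- The states of the Markov chain underlying `R`: the classes that can be reached from the
class of `R`. -/
abbrev State (bar : Act → Rate → Rate) (R : RProc Act Key) : Type (max u v) :=
  {c : Cls Act Key // Relation.ReflTransGen (fun d d' => ∃ l, Trans bar d l d')
    (Quotient.mk _ R) c}

/-- The rate at which the Markov chain underlying `R` moves from `s` to `s'`: the sum of the rates
of all the transitions from `s` to `s'`. -/
noncomputable def rate (bar : Act → Rate → Rate) (R : RProc Act Key) (s s' : State bar R) : ℝ :=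
  ∑ᶠ l ∈ {l : Act × Rate | Trans bar s.1 l s'.1}, (l.2 : ℝ)

end Chain

/-! ### Finite-state continuous-time Markov chains and time reversibility -/

section CTMC

variable {S : Type u}

open Classical in
/-- The infinitesimal generator with off-diagonal entries `q s s'` and rows that sum to `0`. -/
noncomputable def generator [Fintype S] (q : S → S → ℝ) : Matrix S S ℝ :=
  fun s s' => if s = s' then - ∑ s'' ∈ Finset.univ.erase s, q s s'' else q s s'

/-- Steady-state probability distributions: positive solutions of the global balance equations
that sum to `1`. -/
structure IsSteadyState [Fintype S] (q : S → S → ℝ) (p : S → ℝ) : Prop where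
  pos : ∀ s, 0 < p s
  sum_eq_one : ∑ s, p s = 1
  balance : Matrix.vecMul p (generator q) = 0

open Classical in
/-- The stochastic process `X` on the probability space `(Ω, μ)` is a time-homogeneous
continuous-time Markov chain whose rate from `s` to `s' ≠ s` is `q s s'`: it has the Markov
property, and the probability of moving from `s` to `s'` in time `h` is the `(s, s')` entry of
`exp (h Q)`, where `Q` is the generator. -/
structure IsCTMC [Fintype S] (q : S → S → ℝ) {Ω : Type w} [MeasurableSpace Ω] (μ : Measure Ω)
    (X : ℝ≥0 → Ω → S) : Prop where
  measurable : ∀ t s, MeasurableSet {ω | X t ω = s}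
  markov : ∀ (n : ℕ) (t : Fin (n + 2) → ℝ≥0) (s : Fin (n + 2) → S), StrictMono t →
    μ {ω | ∀ k : Fin (n + 1), X (t k.castSucc) ω = s k.castSucc} ≠ 0 →
    cond μ {ω | ∀ k : Fin (n + 1), X (t k.castSucc) ω = s k.castSucc}
        {ω | X (t (Fin.last (n + 1))) ω = s (Fin.last (n + 1))} =
      cond μ {ω | X (t (Fin.last n).castSucc) ω = s (Fin.last n).castSucc}
        {ω | X (t (Fin.last (n + 1))) ω = s (Fin.last (n + 1))}
  transition : ∀ (t h : ℝ≥0) (s s' : S), μ {ω | X t ω = s} ≠ 0 →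
    cond μ {ω | X t ω = s} {ω | X (t + h) ω = s'} =
      ENNReal.ofReal (NormedSpace.exp ((h : ℝ) • generator q) s s')

/-- Stationarity: joint distributions are invariant under shifts of time. -/
def IsStationary {Ω : Type w} [MeasurableSpace Ω] (μ : Measure Ω) (X : ℝ≥0 → Ω → S) : Prop :=
  ∀ (n : ℕ) (t : Fin n → ℝ≥0), StrictMono t → ∀ (t' : ℝ≥0) (s : Fin n → S),
    μ {ω | ∀ k, X (t k + t') ω = s k} = μ {ω | ∀ k, X (t k) ω = s k}

/-- Time reversibility of a process: `(X (t k))` and `(X (t' - t k))` have the same joint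
distribution (whenever the times `t' - t k` are nonnegative). -/
def IsReversible {Ω : Type w} [MeasurableSpace Ω] (μ : Measure Ω) (X : ℝ≥0 → Ω → S) : Prop :=
  ∀ (n : ℕ) (t : Fin n → ℝ≥0), StrictMono t → ∀ t' : ℝ≥0, (∀ k, t k ≤ t') → ∀ s : Fin n → S,
    μ {ω | ∀ k, X (t k) ω = s k} = μ {ω | ∀ k, X (t' - t k) ω = s k}

/-- Time reversibility of the finite-state chain with rates `q`: it has a unique steady-state
probability distribution, this distribution satisfies the partial balance equations, and every
stationary continuous-time Markov chain with these rates is a time reversible process. -/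
def TimeReversible [Fintype S] (q : S → S → ℝ) : Prop :=
  (∃! p : S → ℝ, IsSteadyState q p) ∧
  (∀ p : S → ℝ, IsSteadyState q p → ∀ s s' : S, s ≠ s' → p s * q s s' = p s' * q s' s) ∧
  ∀ (Ω : Type w) [MeasurableSpace Ω] (μ : Measure Ω) [IsProbabilityMeasure μ]
    (X : ℝ≥0 → Ω → S), IsCTMC q μ X → IsStationary μ X → IsReversible μ X

end CTMC

end RMPC

/-! The steady state has product form. Weigh a class by the product, over its executed prefixes, of
forward rate divided by backward rate. A forward transition of rate `lam` multiplies the product of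
forward rates by `lam`, and undoing it at rate `r` divides the product of backward rates by `r`.
This survives synchronization because rates are multiplied there too. Hence the weights of the two
ends satisfy detailed balance for this pair of transitions (`Trans.exists_symm`).

Detailed balance for the chain also needs the summed rates to be controlled. Two classes determine
the label of a transition between them: the executed actions give its direction and action, and the
rate products give its rate (`Trans.label_unique`). So each sum has at most one term.

There are finitely many states because undoing everything gives the same standard process
throughout, and the keys can be renamed into a fixed finite set. The chain is connected because
every transition has an inverse.

The rest holds for any finite connected chain with positive detailed-balance weights
(`TimeReversible.of_detailed_balance`): a maximum principle gives uniqueness, and detailed balance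
passes to `exp (h Q)` and then along paths. -/

namespace RMPC

/-! ### Finite chains satisfying detailed balance -/

section Abstract

variable {S : Type u} [Fintype S] {q : S → S → ℝ} {w : S → ℝ}

open Classical in
-- Distributing the diagonal entry over the sum pairs inflow with outflow, so that detailed balance
-- cancels each term separately.
lemma vecMul_generator_apply (p : S → ℝ) (s' : S) :
    Matrix.vecMul p (generator q) s' =
      ∑ s ∈ Finset.univ.erase s', (p s * q s s' - p s' * q s' s) := by
  have h : Matrix.vecMul p (generator q) s' = ∑ s, p s * generator q s s' := rfl
  rw [h, ← Finset.add_sum_erase _ _ (Finset.mem_univ s'), Finset.sum_sub_distrib,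
    ← Finset.mul_sum]
  have h1 : ∑ s ∈ Finset.univ.erase s', p s * generator q s s' =
      ∑ s ∈ Finset.univ.erase s', p s * q s s' := by
    refine Finset.sum_congr rfl fun s hs => ?_
    rw [generator, if_neg (Finset.ne_of_mem_erase hs)]
  rw [h1, generator, if_pos rfl]
  ring

/-- Detailed balance implies global balance. -/
lemma vecMul_generator_eq_zero (hw : ∀ s s', s ≠ s' → w s * q s s' = w s' * q s' s) :
    Matrix.vecMul w (generator q) = 0 := by
  classical
  funext s'
  rw [vecMul_generator_apply]
  exact Finset.sum_eq_zero fun s hs => sub_eq_zero.2 (hw s s' (Finset.ne_of_mem_erase hs))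

/-- Every solution of the global balance equations of a connected chain is a multiple of a
positive solution of the detailed balance equations (maximum principle). -/
lemma exists_eq_const_mul (hq : ∀ s s', 0 ≤ q s s') (hpos : ∀ s, 0 < w s)
    (hw : ∀ s s', s ≠ s' → w s * q s s' = w s' * q s' s)
    (hconn : ∀ s s', Relation.ReflTransGen (fun a b => a ≠ b ∧ 0 < q a b) s s')
    {p : S → ℝ} (hp : Matrix.vecMul p (generator q) = 0) : ∃ c : ℝ, ∀ s, p s = c * w s := by
  classical
  rcases isEmpty_or_nonempty S with hS | hS
  · exact ⟨0, fun s => hS.elim s⟩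
  obtain ⟨m, hm⟩ := Finite.exists_max fun s => p s / w s
  refine ⟨p m / w m, fun s => ?_⟩
  suffices h : p s / w s = p m / w m by rw [← h, div_mul_cancel₀ _ (hpos s).ne']
  induction hconn m s with
  | refl => rfl
  | @tail b c _ hbc ih =>
    -- By `ih` the ratio `p / w` is maximal at `b`. Detailed balance turns the balance equation at
    -- `b` into a vanishing sum of nonpositive terms, so the ratio is also maximal at every
    -- successor of `b`.
    have hb := congrFun hp b
    rw [vecMul_generator_apply] at hb
    have hterm : ∀ s ∈ Finset.univ.erase b, p s * q s b - p b * q b s =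
        w b * q b s * (p s / w s - p b / w b) := fun s hs => by
      have h1 := hw s b (Finset.ne_of_mem_erase hs)
      have hs0 := (hpos s).ne'
      have hb0 := (hpos b).ne'
      field_simp
      linear_combination p s * h1
    rw [Finset.sum_congr rfl hterm, Pi.zero_apply, Finset.sum_eq_zero_iff_of_nonpos] at hb
    · have h2 := hb c (Finset.mem_erase.2 ⟨hbc.1.symm, Finset.mem_univ _⟩)
      rcases mul_eq_zero.1 h2 with h3 | h3
      · exact absurd h3 (mul_pos (hpos b) hbc.2).ne'
      · linarith
    · intro s _
      refine mul_nonpos_of_nonneg_of_nonpos (mul_nonneg (hpos b).le (hq b s)) ?_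
      rw [ih]
      exact sub_nonpos.2 (hm s)

open Classical in
/-- Detailed balance passes from the generator to the transition probabilities. -/
lemma exp_generator_detailed_balance (hpos : ∀ s, 0 < w s)
    (hw : ∀ s s', s ≠ s' → w s * q s s' = w s' * q s' s) (h : ℝ) (s s' : S) :
    w s * NormedSpace.exp (h • generator q) s s' =
      w s' * NormedSpace.exp (h • generator q) s' s := by
  set A : Matrix S S ℝ := h • generator q
  have hdet : IsUnit (Matrix.diagonal w).det := by
    rw [Matrix.det_diagonal]
    exact (Finset.prod_pos fun s _ => hpos s).ne'.isUnit
  have hU : IsUnit (Matrix.diagonal w) := (Matrix.isUnit_iff_isUnit_det _).2 hdet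
  have hA : Matrix.diagonal w * A = A.transpose * Matrix.diagonal w := by
    ext a b
    rw [Matrix.diagonal_mul, Matrix.mul_diagonal, Matrix.transpose_apply]
    change w a * (h * generator q a b) = h * generator q b a * w b
    rcases eq_or_ne a b with rfl | hab
    · ring
    · rw [generator, generator, if_neg hab, if_neg hab.symm]
      linear_combination h * hw a b hab
  -- Detailed balance says that `diagonal w` conjugates `A` into its transpose; the exponential
  -- commutes with both conjugation and transposition.
  have hconj : Matrix.diagonal w * A * (Matrix.diagonal w)⁻¹ = A.transpose := by
    rw [hA, Matrix.mul_nonsing_inv_cancel_right _ _ hdet]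
  have h1 := Matrix.exp_conj (Matrix.diagonal w) A hU
  rw [hconj, Matrix.exp_transpose] at h1
  have h2 : (NormedSpace.exp A).transpose * Matrix.diagonal w =
      Matrix.diagonal w * NormedSpace.exp A := by
    rw [h1, Matrix.nonsing_inv_mul_cancel_right _ _ hdet]
  have h3 := congrFun (congrFun h2 s) s'
  rw [Matrix.diagonal_mul, Matrix.mul_diagonal, Matrix.transpose_apply] at h3
  rw [← h3, mul_comm]

section
attribute [local instance] Matrix.linftyOpNormedRing Matrix.linftyOpNormedAlgebra

open Classical in
/-- A distribution that is invariant under all transition matrices solves the global balance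
equations. -/
lemma vecMul_generator_eq_zero_of_exp {p : S → ℝ}
    (hp : ∀ h : ℝ, 0 ≤ h → Matrix.vecMul p (NormedSpace.exp (h • generator q)) = p) :
    Matrix.vecMul p (generator q) = 0 := by
  have h1 := hasDerivAt_exp_smul_const (𝕂 := ℝ) (generator q) (0 : ℝ)
  rw [zero_smul, NormedSpace.exp_zero, one_mul] at h1
  let L : Matrix S S ℝ →ₗ[ℝ] (S → ℝ) := Matrix.vecMulBilin ℝ ℝ p
  have hL : ∀ M, L M = Matrix.vecMul p M := fun M => rfl
  have h2 := (L.toContinuousLinearMap.hasFDerivAt.comp_hasDerivAt (0 : ℝ) h1).hasDerivWithinAt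
    (s := Set.Ici 0)
  -- Invariance is known only for nonnegative times, hence one-sided derivatives at `0`.
  have h3 : HasDerivWithinAt (L ∘ fun t : ℝ => NormedSpace.exp (t • generator q)) 0
      (Set.Ici 0) 0 :=
    (hasDerivWithinAt_const (0 : ℝ) (Set.Ici 0) p).congr (fun t ht => hp t ht) (hp 0 le_rfl)
  exact UniqueDiffWithinAt.eq_deriv (Set.Ici (0 : ℝ)) (uniqueDiffWithinAt_Ici 0) h2 h3

end

/-! ### Finite-dimensional distributions -/

variable {Ω : Type w} [MeasurableSpace Ω] {μ : Measure Ω} {X : ℝ≥0 → Ω → S}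

open Classical in
/-- The transition probabilities of a chain with rates `q`, as extended nonnegative reals. -/
noncomputable def transProb (q : S → S → ℝ) (h : ℝ≥0) (s s' : S) : ENNReal :=
  ENNReal.ofReal (NormedSpace.exp ((h : ℝ) • generator q) s s')

lemma transProb_ne_top (h : ℝ≥0) (s s' : S) : transProb q h s s' ≠ ⊤ :=
  ENNReal.ofReal_ne_top

lemma IsCTMC.measure_inter (hX : IsCTMC q μ X) [IsFiniteMeasure μ] (t h : ℝ≥0) (s s' : S) :
    μ ({ω | X t ω = s} ∩ {ω | X (t + h) ω = s'}) = μ {ω | X t ω = s} * transProb q h s s' := by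
  by_cases h0 : μ {ω | X t ω = s} = 0
  · rw [h0, zero_mul]
    exact measure_mono_null Set.inter_subset_left h0
  · rw [transProb, ← hX.transition t h s s' h0, cond_apply (hX.measurable t s),
      ENNReal.mul_inv_cancel_left h0 (measure_ne_top _ _)]

lemma IsCTMC.measure_path (hX : IsCTMC q μ X) [IsFiniteMeasure μ] (n : ℕ)
    (t : Fin (n + 1) → ℝ≥0) (ht : StrictMono t) (s : Fin (n + 1) → S) :
    μ {ω | ∀ k, X (t k) ω = s k} = μ {ω | X (t 0) ω = s 0} *
      ∏ k : Fin n, transProb q (t k.succ - t k.castSucc) (s k.castSucc) (s k.succ) := by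
  induction n with
  | zero => simp
  | succ n ih =>
    have ih' := ih (fun k => t k.castSucc) (fun a b hab => ht hab) (fun k => s k.castSucc)
    have hset : {ω | ∀ k, X (t k) ω = s k} =
        {ω | ∀ k : Fin (n + 1), X (t k.castSucc) ω = s k.castSucc} ∩
          {ω | X (t (Fin.last (n + 1))) ω = s (Fin.last (n + 1))} := by
      ext ω
      exact Fin.forall_fin_succ'
    have hmeas : MeasurableSet {ω | ∀ k : Fin (n + 1), X (t k.castSucc) ω = s k.castSucc} := by
      rw [Set.ofPred_forall]
      exact MeasurableSet.iInter fun k => hX.measurable _ _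
    rw [Fin.prod_univ_castSucc, ← mul_assoc]
    simp only [Fin.succ_castSucc, Fin.castSucc_zero] at ih' ⊢
    rw [← ih', hset]
    -- The conditional probabilities are prescribed only for non-null conditioning events; in the
    -- null case both sides vanish.
    by_cases h0 : μ {ω | ∀ k : Fin (n + 1), X (t k.castSucc) ω = s k.castSucc} = 0
    · rw [h0, zero_mul]
      exact measure_mono_null Set.inter_subset_left h0
    have hlast : μ {ω | X (t (Fin.last n).castSucc) ω = s (Fin.last n).castSucc} ≠ 0 :=
      fun h => h0 (measure_mono_null (fun ω hω => hω (Fin.last n)) h)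
    have hle : t (Fin.last n).castSucc ≤ t (Fin.last (n + 1)) :=
      ht.monotone (Fin.le_last _)
    have hmk := hX.markov n t s ht h0
    have htr := hX.transition (t (Fin.last n).castSucc)
      (t (Fin.last (n + 1)) - t (Fin.last n).castSucc) (s (Fin.last n).castSucc)
      (s (Fin.last (n + 1))) hlast
    rw [add_tsub_cancel_of_le hle] at htr
    rw [htr, cond_apply hmeas] at hmk
    rw [Fin.succ_last, transProb, ← hmk, ENNReal.mul_inv_cancel_left h0 (measure_ne_top _ _)]

lemma IsStationary.measure_eq {S : Type u} {Ω : Type w} [MeasurableSpace Ω] {μ : Measure Ω}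
    {X : ℝ≥0 → Ω → S} (hst : IsStationary μ X) (t : ℝ≥0) (s : S) :
    μ {ω | X t ω = s} = μ {ω | X 0 ω = s} := by
  have := hst 1 (fun _ => 0) (Subsingleton.strictMono _) t fun _ => s
  simpa using this

open Classical in
lemma transProb_detailed_balance (hpos : ∀ s, 0 < w s)
    (hw : ∀ s s', s ≠ s' → w s * q s s' = w s' * q s' s) {c : ℝ} {m : S → ENNReal}
    (hc : 0 ≤ c) (hm : ∀ s, m s = ENNReal.ofReal (c * w s)) (h : ℝ≥0) (s s' : S) :
    m s * transProb q h s s' = m s' * transProb q h s' s := by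
  rw [hm, hm, transProb, transProb,
    ← ENNReal.ofReal_mul (mul_nonneg hc (hpos s).le),
    ← ENNReal.ofReal_mul (mul_nonneg hc (hpos s').le), mul_assoc,
    exp_generator_detailed_balance hpos hw, mul_assoc]

/-- The factor `m` is carried from the start of the path to its end, reversing one transition at
each step. -/
lemma path_reverse {S : Type u} {m : S → ENNReal} {P : ℝ≥0 → S → S → ENNReal}
    (hm : ∀ h s s', m s * P h s s' = m s' * P h s' s) (n : ℕ) (h : Fin n → ℝ≥0)
    (s : Fin (n + 1) → S) :
    m (s 0) * ∏ k : Fin n, P (h k) (s k.castSucc) (s k.succ) =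
      m (s (Fin.last n)) * ∏ k : Fin n, P (h k) (s k.succ) (s k.castSucc) := by
  induction n with
  | zero => simp
  | succ n ih =>
    have := ih (fun k => h k.castSucc) (fun k => s k.castSucc)
    rw [Fin.prod_univ_castSucc, Fin.prod_univ_castSucc, ← mul_assoc]
    simp only [Fin.succ_castSucc, Fin.castSucc_zero] at this ⊢
    rw [this, mul_right_comm, hm, Fin.succ_last, mul_right_comm, mul_assoc]

open Classical in
lemma generator_mulVec_one : Matrix.mulVec (generator q) 1 = 0 := by
  funext s
  have h : Matrix.mulVec (generator q) 1 s = ∑ s', generator q s s' := by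
    simp [Matrix.mulVec, dotProduct]
  rw [h, ← Finset.add_sum_erase _ _ (Finset.mem_univ s), generator, if_pos rfl, Pi.zero_apply,
    neg_add_eq_zero]
  refine Finset.sum_congr rfl fun s' hs' => ?_
  rw [generator, if_neg (Finset.ne_of_mem_erase hs').symm]

section
attribute [local instance] Matrix.linftyOpNormedRing Matrix.linftyOpNormedAlgebra

open Classical in
-- Only the constant term of the exponential series acts on `v` nontrivially.
lemma exp_mulVec_of_mulVec_eq_zero {A : Matrix S S ℝ} {v : S → ℝ} (hA : Matrix.mulVec A v = 0) :
    Matrix.mulVec (NormedSpace.exp A) v = v := by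
  have h1 := NormedSpace.exp_series_hasSum_exp' (𝕂 := ℝ) A
  let L : Matrix S S ℝ →ₗ[ℝ] (S → ℝ) := (Matrix.mulVecBilin ℝ ℝ).flip v
  have h2 := h1.mapL L.toContinuousLinearMap
  refine h2.unique ?_
  have h3 : HasSum (fun n : ℕ => if n = 0 then v else 0) v := hasSum_ite_eq 0 v
  have hfun : (fun n : ℕ => L.toContinuousLinearMap ((n.factorial : ℝ)⁻¹ • A ^ n)) =
      fun n : ℕ => if n = 0 then v else 0 := by
    funext n
    change Matrix.mulVec ((n.factorial : ℝ)⁻¹ • A ^ n) v = _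
    rcases n with _ | n
    · simp
    · rw [if_neg (Nat.succ_ne_zero n), Matrix.smul_mulVec, pow_succ, ← Matrix.mulVec_mulVec, hA,
        Matrix.mulVec_zero, smul_zero]
  rw [hfun]
  exact h3

end

open Classical in
lemma sum_exp_generator (h : ℝ) (s : S) :
    ∑ s', NormedSpace.exp (h • generator q) s s' = 1 := by
  have hA : Matrix.mulVec (h • generator q) 1 = 0 := by
    rw [Matrix.smul_mulVec, generator_mulVec_one, smul_zero]
  have := congrFun (exp_mulVec_of_mulVec_eq_zero hA) s
  simpa [Matrix.mulVec, dotProduct] using this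

lemma IsCTMC.sum_measure_inter (hX : IsCTMC q μ X) (t : ℝ≥0) {A : Set Ω}
    (hA : MeasurableSet A) : ∑ s, μ (A ∩ {ω | X t ω = s}) = μ A := by
  have hdisj : ((Finset.univ : Finset S) : Set S).PairwiseDisjoint
      fun s => A ∩ {ω | X t ω = s} := fun a _ b _ hab =>
    Set.disjoint_left.2 fun ω h1 h2 => hab (h1.2.symm.trans h2.2)
  rw [← measure_biUnion_finset hdisj fun s _ => hA.inter (hX.measurable t s)]
  congr 1
  ext ω
  simp

open Classical in
-- `ENNReal.ofReal` truncates negative entries to `0`, so nonnegativity needs an argument. The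
-- truncated row sums to `1` as a row of conditional probabilities, and the untruncated row sums to
-- `1` as well; since truncation never decreases an entry, it changes none.
lemma IsCTMC.exp_nonneg (hX : IsCTMC q μ X) [IsFiniteMeasure μ] {t : ℝ≥0} {s : S}
    (hs : μ {ω | X t ω = s} ≠ 0) (h : ℝ≥0) (s' : S) :
    0 ≤ NormedSpace.exp ((h : ℝ) • generator q) s s' := by
  have h1 := hX.sum_measure_inter (t + h) (hX.measurable t s)
  rw [Finset.sum_congr rfl fun s' _ => hX.measure_inter t h s s', ← Finset.mul_sum] at h1
  have h2 : ∑ s', transProb q h s s' = 1 :=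
    (ENNReal.mul_right_inj hs (measure_ne_top _ _)).1 (h1.trans (mul_one _).symm)
  have h3 := congrArg ENNReal.toReal h2
  rw [ENNReal.toReal_sum fun _ _ => transProb_ne_top _ _ _, ENNReal.toReal_one,
    ← sum_exp_generator (q := q) (h : ℝ) s, ← sub_eq_zero, ← Finset.sum_sub_distrib,
    Finset.sum_eq_zero_iff_of_nonneg] at h3
  · rw [← sub_eq_zero.1 (h3 s' (Finset.mem_univ _))]
    exact ENNReal.toReal_nonneg
  · intro s' _
    rw [transProb, ENNReal.toReal_ofReal']
    exact sub_nonneg.2 (le_max_left _ _)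

open Classical in
/-- The one-dimensional distribution of a stationary chain solves the global balance equations. -/
lemma IsCTMC.vecMul_generator_eq_zero (hX : IsCTMC q μ X) [IsFiniteMeasure μ]
    (hst : IsStationary μ X) :
    Matrix.vecMul (fun s => (μ {ω | X 0 ω = s}).toReal) (generator q) = 0 := by
  refine vecMul_generator_eq_zero_of_exp fun h hh => ?_
  lift h to ℝ≥0 using hh
  funext s'
  have h1 := hX.sum_measure_inter 0 (hX.measurable (0 + h) s')
  rw [hst.measure_eq, Finset.sum_congr rfl fun s _ => by
    rw [Set.inter_comm, hX.measure_inter 0 h s s']] at h1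
  change ∑ s, (μ {ω | X 0 ω = s}).toReal * NormedSpace.exp ((h : ℝ) • generator q) s s' =
    (μ {ω | X 0 ω = s'}).toReal
  rw [← h1, ENNReal.toReal_sum fun s _ =>
    ENNReal.mul_ne_top (measure_ne_top _ _) (transProb_ne_top _ _ _)]
  refine Finset.sum_congr rfl fun s _ => ?_
  rw [ENNReal.toReal_mul]
  by_cases h0 : μ {ω | X 0 ω = s} = 0
  · rw [h0, ENNReal.toReal_zero, zero_mul, zero_mul]
  · rw [transProb, ENNReal.toReal_ofReal (hX.exp_nonneg h0 h s')]

lemma IsCTMC.isReversible (hX : IsCTMC q μ X) [IsProbabilityMeasure μ] (hst : IsStationary μ X)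
    (hq : ∀ s s', 0 ≤ q s s') (hpos : ∀ s, 0 < w s)
    (hw : ∀ s s', s ≠ s' → w s * q s s' = w s' * q s' s)
    (hconn : ∀ s s', Relation.ReflTransGen (fun a b => a ≠ b ∧ 0 < q a b) s s') :
    IsReversible μ X := by
  obtain ⟨c, hc⟩ := exists_eq_const_mul hq hpos hw hconn (hX.vecMul_generator_eq_zero hst)
  have hm : ∀ s, μ {ω | X 0 ω = s} = ENNReal.ofReal (c * w s) := fun s => by
    rw [← hc, ENNReal.ofReal_toReal (measure_ne_top _ _)]
  rintro (_ | n) t ht t' ht' s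
  · simp
  -- The sign of `c` is read off at a state, available here because the empty family of times has
  -- been treated.
  have hc0 : 0 ≤ c := by
    have h1 := hc (s 0)
    by_contra hneg
    have h2 := mul_neg_of_neg_of_pos (not_le.1 hneg) (hpos (s 0))
    rw [← h1] at h2
    exact absurd ENNReal.toReal_nonneg (not_le.2 h2)
  have hdb : ∀ (h : ℝ≥0) (s s' : S), μ {ω | X 0 ω = s} * transProb q h s s' =
      μ {ω | X 0 ω = s'} * transProb q h s' s :=
    transProb_detailed_balance (m := fun s => μ {ω | X 0 ω = s}) hpos hw hc0 hm
  -- The reflected times decrease, so they are listed backwards before the path formula is applied.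
  have hr : StrictMono fun k : Fin (n + 1) => t' - t k.rev := fun a b hab =>
    (tsub_lt_tsub_iff_left_of_le (ht' _)).2 (ht (Fin.rev_lt_rev.2 hab))
  have hset : {ω | ∀ k, X (t' - t k) ω = s k} =
      {ω | ∀ k : Fin (n + 1), X (t' - t k.rev) ω = s k.rev} := by
    ext ω
    exact Fin.rev_surjective.forall
  rw [hset, hX.measure_path n t ht s, hX.measure_path n _ hr fun k => s k.rev, hst.measure_eq (t 0),
    hst.measure_eq (t' - _), path_reverse (m := fun s => μ {ω | X 0 ω = s}) hdb, Fin.rev_zero,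
    ← Equiv.prod_comp Fin.revPerm fun k : Fin n =>
      transProb q (t' - t k.succ.rev - (t' - t k.castSucc.rev)) _ _]
  refine congrArg _ (Finset.prod_congr rfl fun k _ => ?_)
  rw [Fin.revPerm_apply, Fin.rev_succ, Fin.rev_castSucc, Fin.rev_rev,
    tsub_tsub_tsub_cancel_left (ht' _)]

/-- A connected chain whose rates satisfy the detailed balance equations is time reversible. -/
theorem TimeReversible.of_detailed_balance [Nonempty S] (hq : ∀ s s', 0 ≤ q s s')
    (hpos : ∀ s, 0 < w s) (hw : ∀ s s', s ≠ s' → w s * q s s' = w s' * q s' s)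
    (hconn : ∀ s s', Relation.ReflTransGen (fun a b => a ≠ b ∧ 0 < q a b) s s') :
    TimeReversible.{u, v} q := by
  have hW : 0 < ∑ s, w s := Finset.sum_pos (fun s _ => hpos s) Finset.univ_nonempty
  set p : S → ℝ := fun s => (∑ s, w s)⁻¹ * w s with hp
  have hpw : ∀ s s', s ≠ s' → p s * q s s' = p s' * q s' s := fun s s' hs => by
    rw [hp, mul_assoc, hw s s' hs, mul_assoc]
  have huniq : ∀ p', IsSteadyState q p' → p' = p := fun p' hp' => by
    obtain ⟨c, hc⟩ := exists_eq_const_mul hq hpos hw hconn hp'.balance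
    have h1 := hp'.sum_eq_one
    rw [Finset.sum_congr rfl fun s _ => hc s, ← Finset.mul_sum] at h1
    funext s
    rw [hc, eq_inv_of_mul_eq_one_left h1]
  refine ⟨⟨p, ⟨fun s => mul_pos (inv_pos.2 hW) (hpos s), ?_, vecMul_generator_eq_zero hpw⟩,
    huniq⟩, fun p' hp' => by rwa [huniq p' hp'], fun Ω _ μ _ X hX hst =>
    hX.isReversible hst hq hpos hw hconn⟩
  rw [← Finset.mul_sum, inv_mul_cancel₀ hW.ne']

end Abstract


/-! ### Invariants of processes under renaming of keys -/

namespace Proc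

variable {Act : Type u} {Key : Type v}

/-- The standard process obtained by undoing all executed prefixes. -/
def initial : Proc Act Key → Proc Act Key
  | nil => nil
  | pre a lam R => pre a lam R.initial
  | past a lam _ R => pre a lam R.initial
  | choice R S => choice R.initial S.initial
  | par L R S => par L R.initial S.initial

/-- The number of prefixes, executed or not. -/
def numPrefixes : Proc Act Key → ℕ
  | nil => 0
  | pre _ _ R => R.numPrefixes + 1
  | past _ _ _ R => R.numPrefixes + 1
  | choice R S => R.numPrefixes + S.numPrefixes
  | par _ R S => R.numPrefixes + S.numPrefixes

/-- The multiset of the actions of the executed prefixes. -/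
def executed : Proc Act Key → Multiset Act
  | nil => 0
  | pre _ _ R => R.executed
  | past a _ _ R => {a} + R.executed
  | choice R S => R.executed + S.executed
  | par _ R S => R.executed + S.executed

/-- The product of the values of `f` at all executed prefixes. -/
noncomputable def rateProd (f : Act → Rate → Rate) : Proc Act Key → ℝ
  | nil => 1
  | pre _ _ R => R.rateProd f
  | past a lam _ R => f a lam * R.rateProd f
  | choice R S => R.rateProd f * S.rateProd f
  | par _ R S => R.rateProd f * S.rateProd f

lemma rateProd_pos (f : Act → Rate → Rate) (R : Proc Act Key) : 0 < R.rateProd f := by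
  induction R with
  | nil => exact one_pos
  | pre a lam R ih => exact ih
  | past a lam i R ih => exact mul_pos (f a lam).2 ih
  | choice R S ihR ihS => exact mul_pos ihR ihS
  | par L R S ihR ihS => exact mul_pos ihR ihS

lemma numPrefixes_initial (R : Proc Act Key) : R.initial.numPrefixes = R.numPrefixes := by
  induction R <;> simp_all [initial, numPrefixes]

section Rekey

variable (i j : Key) (R : Proc Act Key)

lemma initial_rekey : (R.rekey i j).initial = R.initial := by
  induction R <;> simp_all [initial, rekey]

lemma executed_rekey : (R.rekey i j).executed = R.executed := by
  induction R <;> simp_all [executed, rekey]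

lemma rateProd_rekey (f : Act → Rate → Rate) : (R.rekey i j).rateProd f = R.rateProd f := by
  induction R <;> simp_all [rateProd, rekey]

lemma std_rekey : (R.rekey i j).Std ↔ R.Std := by
  induction R <;> simp_all [Std, rekey]

variable {R} in
lemma Std.rekey_eq (h : R.Std) : R.rekey i j = R := by
  induction R <;> simp_all [Std, rekey]

open Classical in
lemma keys_rekey : (R.rekey i j).keys = (fun k => if k = i then j else k) '' R.keys := by
  induction R <;> simp_all [keys, rekey, Set.image_union, Set.image_insert_eq]

end Rekey

lemma finite_keys (R : Proc Act Key) : R.keys.Finite := by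
  induction R <;> simp_all [keys]

lemma ncard_keys_le (R : Proc Act Key) : R.keys.ncard ≤ R.numPrefixes := by
  induction R with
  | nil => simp [keys]
  | pre a lam R ih => exact ih.trans (Nat.le_succ _)
  | past a lam i R ih =>
    rw [keys, Set.singleton_union]
    exact (Set.ncard_insert_le _ _).trans (Nat.succ_le_succ ih)
  | choice R S ihR ihS => exact (Set.ncard_union_le _ _).trans (Nat.add_le_add ihR ihS)
  | par L R S ihR ihS => exact (Set.ncard_union_le _ _).trans (Nat.add_le_add ihR ihS)

/-- There are only finitely many processes with given prefixes and keys from a given finite set. -/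
lemma finite_initial_eq (F : Set Key) (hF : F.Finite) (P : Proc Act Key) :
    {R : Proc Act Key | R.initial = P ∧ R.keys ⊆ F}.Finite := by
  induction P with
  | nil =>
    refine (Set.finite_singleton nil).subset ?_
    rintro (_ | _ | _ | _ | _) ⟨h, -⟩ <;> simp_all [initial]
  | pre a lam P ih =>
    refine ((ih.image (pre a lam)).union
      (Set.Finite.image2 (fun i R => past a lam i R) hF ih)).subset ?_
    rintro (_ | _ | _ | _ | _) ⟨h, hk⟩ <;> simp only [initial, reduceCtorEq, pre.injEq] at h
    · obtain ⟨rfl, rfl, h⟩ := h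
      exact Or.inl ⟨_, ⟨h, hk⟩, rfl⟩
    · obtain ⟨rfl, rfl, h⟩ := h
      exact Or.inr ⟨_, hk (Or.inl rfl), _, ⟨h, fun k hk' => hk (Or.inr hk')⟩, rfl⟩
  | past a lam i P ih =>
    convert Set.finite_empty
    ext R
    cases R <;> simp [initial]
  | choice P Q ihP ihQ =>
    refine (Set.Finite.image2 choice ihP ihQ).subset ?_
    rintro (_ | _ | _ | _ | _) ⟨h, hk⟩ <;> simp only [initial, reduceCtorEq, choice.injEq] at h
    exact ⟨_, ⟨h.1, fun k hk' => hk (Or.inl hk')⟩, _, ⟨h.2, fun k hk' => hk (Or.inr hk')⟩, rfl⟩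
  | par L P Q ihP ihQ =>
    refine (Set.Finite.image2 (par L) ihP ihQ).subset ?_
    rintro (_ | _ | _ | _ | _) ⟨h, hk⟩ <;> simp only [initial, reduceCtorEq, par.injEq] at h
    obtain ⟨rfl, h⟩ := h
    exact ⟨_, ⟨h.1, fun k hk' => hk (Or.inl hk')⟩, _, ⟨h.2, fun k hk' => hk (Or.inr hk')⟩, rfl⟩

end Proc

/-! ### Effect of transitions on the invariants -/

section Transitions

variable {Act : Type u} {Key : Type v} {bar : Act → Rate → Rate} {R R' : Proc Act Key} {a : Act}
  {lam : Rate} {i : Key}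

/-- Every forward transition can be undone. -/
lemma Fwd.exists_bwd (bar : Act → Rate → Rate) (h : Fwd R a lam i R') :
    ∃ r, Bwd bar R' a r i R := by
  induction h with
  | act1 hR => exact ⟨_, .act1 hR⟩
  | act2 _ hj ih => exact ⟨_, .act2 ih.choose_spec hj⟩
  | choL _ hS ih => exact ⟨_, .choL ih.choose_spec hS⟩
  | choR _ hS ih => exact ⟨_, .choR ih.choose_spec hS⟩
  | parL _ ha hi ih => exact ⟨_, .parL ih.choose_spec ha hi⟩
  | parR _ ha hi ih => exact ⟨_, .parR ih.choose_spec ha hi⟩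
  | coo _ _ ha ih ih' => exact ⟨_, .coo ih.choose_spec ih'.choose_spec ha⟩

/-- Every backward transition can be redone. -/
lemma Bwd.exists_fwd (h : Bwd bar R a lam i R') : ∃ r, Fwd R' a r i R := by
  induction h with
  | act1 hR => exact ⟨_, .act1 hR⟩
  | act2 _ hj ih => exact ⟨_, .act2 ih.choose_spec hj⟩
  | choL _ hS ih => exact ⟨_, .choL ih.choose_spec hS⟩
  | choR _ hS ih => exact ⟨_, .choR ih.choose_spec hS⟩
  | parL _ ha hi ih => exact ⟨_, .parL ih.choose_spec ha hi⟩
  | parR _ ha hi ih => exact ⟨_, .parR ih.choose_spec ha hi⟩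
  | coo _ _ ha ih ih' => exact ⟨_, .coo ih.choose_spec ih'.choose_spec ha⟩

lemma Fwd.initial_eq (h : Fwd R a lam i R') : R'.initial = R.initial := by
  induction h <;> simp_all [Proc.initial]

lemma Fwd.keys_eq (h : Fwd R a lam i R') : R'.keys = insert i R.keys := by
  induction h <;> simp_all only [Proc.keys] <;> ext <;> simp <;> tauto

/-- A synchronization executes several prefixes at once, all with the same action; `n + 1` records
that there is at least one. -/
lemma Fwd.executed_eq (h : Fwd R a lam i R') :
    ∃ n, R'.executed = R.executed + Multiset.replicate (n + 1) a := by
  induction h with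
  | act1 _ => exact ⟨0, by simp [Proc.executed, add_comm]⟩
  | act2 _ _ ih | choR _ _ ih | parR _ _ _ ih =>
    obtain ⟨n, hn⟩ := ih
    exact ⟨n, by simp only [Proc.executed, hn, add_assoc]⟩
  | choL _ _ ih | parL _ _ _ ih =>
    obtain ⟨n, hn⟩ := ih
    exact ⟨n, by simp only [Proc.executed, hn, add_right_comm]⟩
  | coo _ _ _ ih ih' =>
    obtain ⟨n, hn⟩ := ih
    obtain ⟨m, hm⟩ := ih'
    refine ⟨n + 1 + m, ?_⟩
    rw [Proc.executed, Proc.executed, hn, hm, add_add_add_comm, ← Multiset.replicate_add]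
    rfl

lemma Fwd.rateProd_eq (h : Fwd R a lam i R') :
    R'.rateProd (fun _ l => l) = R.rateProd (fun _ l => l) * lam := by
  induction h <;> simp_all only [Proc.rateProd, Positive.val_mul] <;> ring

lemma Bwd.rateProd_eq (h : Bwd bar R a lam i R') :
    R.rateProd bar = R'.rateProd bar * lam := by
  induction h <;> simp_all only [Proc.rateProd, Positive.val_mul] <;> ring

open Classical in
-- Freshness is required in the target, whose keys include `k`; thus `j` differs from `k` too, and
-- the renaming creates no clash in the side conditions.
lemma Fwd.rekey {j k : Key} (h : Fwd R a lam k R') (hj : j ∉ R'.keys) :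
    Fwd (R.rekey i j) a lam (if k = i then j else k) (R'.rekey i j) := by
  have hfresh : ∀ {S : Proc Act Key} {k : Key}, k ∉ S.keys → k ≠ j → j ∉ S.keys →
      (if k = i then j else k) ∉ (S.rekey i j).keys := by
    intro S k hk hkj hj
    rw [Proc.keys_rekey]
    rintro ⟨l, hl, hlk⟩
    dsimp only at hlk
    split_ifs at hlk <;> simp_all
  induction h with
  | act1 hR => exact .act1 ((Proc.std_rekey _ _ _).2 hR)
  | @act2 a b lam mu l k R R' h hkl ih =>
    have hj' : j ≠ l ∧ j ∉ R'.keys := by simpa [Proc.keys] using hj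
    refine .act2 (ih hj'.2) ?_
    have hk := h.keys_eq ▸ Set.mem_insert k R.keys
    have hkj : k ≠ j := fun h => hj'.2 (h ▸ hk)
    split_ifs <;> simp_all
  | choL h hS ih =>
    simp only [Proc.keys, Set.mem_union, not_or] at hj
    exact .choL (ih hj.1) ((Proc.std_rekey _ _ _).2 hS)
  | choR h hS ih =>
    simp only [Proc.keys, Set.mem_union, not_or] at hj
    exact .choR (ih hj.2) ((Proc.std_rekey _ _ _).2 hS)
  | parL h ha hi ih =>
    simp only [Proc.keys, Set.mem_union, not_or] at hj
    have hk := h.keys_eq ▸ Set.mem_insert _ _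
    exact .parL (ih hj.1) ha (hfresh hi (fun h => hj.1 (h ▸ hk)) hj.2)
  | parR h ha hi ih =>
    simp only [Proc.keys, Set.mem_union, not_or] at hj
    have hk := h.keys_eq ▸ Set.mem_insert _ _
    exact .parR (ih hj.2) ha (hfresh hi (fun h => hj.2 (h ▸ hk)) hj.1)
  | coo h h' ha ih ih' =>
    simp only [Proc.keys, Set.mem_union, not_or] at hj
    exact .coo (ih hj.1) (ih' hj.2) ha

/-- Keys only accumulate along forward transitions, so `j` is fresh throughout the computation,
which can be renamed step by step. -/
lemma Reachable.rekey (h : Reachable R) {j : Key} (hj : j ∉ R.keys) :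
    Reachable (R.rekey i j) := by
  obtain ⟨P, hP, h⟩ := h
  refine ⟨P, hP, ?_⟩
  induction h with
  | refl => rw [hP.rekey_eq]
  | tail _ hbc ih =>
    obtain ⟨a, lam, k, hbc⟩ := hbc
    refine (ih fun h => hj ?_).tail ⟨a, lam, _, hbc.rekey hj⟩
    rw [hbc.keys_eq]
    exact Or.inr h

end Transitions

/-! ### The Markov chain on classes -/

section Classes

variable {Act : Type u} {Key : Type v} {bar : Act → Rate → Rate}

/-- Functions of processes that do not depend on the keys descend to classes. -/
def Cls.lift {α : Type*} (f : Proc Act Key → α) (hf : ∀ i j R, f (R.rekey i j) = f R) :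
    Cls Act Key → α :=
  Quotient.lift (fun R => f R.1) fun R R' h => by
    have h' : Relation.EqvGen (fun R R' : RProc Act Key =>
      ∃ i j, j ∉ R.1.keys ∧ R'.1 = R.1.rekey i j) R R' := h
    induction h' with
    | rel x y hxy =>
      obtain ⟨i, j, -, hy⟩ := hxy
      change f x.1 = f y.1
      rw [hy, hf]
    | refl x => rfl
    | symm x y hxy ih => exact (ih hxy).symm
    | trans x y z hxy hyz ih ih' => exact (ih hxy).trans (ih' hyz)

/-- The initial process of a class. -/
def Cls.initial : Cls Act Key → Proc Act Key := Cls.lift Proc.initial Proc.initial_rekey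

/-- The executed actions of a class. -/
def Cls.executed : Cls Act Key → Multiset Act := Cls.lift Proc.executed Proc.executed_rekey

/-- The product of the values of `f` at all executed prefixes of a class. -/
noncomputable def Cls.rateProd (f : Act → Rate → Rate) : Cls Act Key → ℝ :=
  Cls.lift (Proc.rateProd f) fun i j R => R.rateProd_rekey i j f

/-- The weight of a class: the product of the ratios of the forward to the backward rates of the
executed prefixes. -/
noncomputable def Cls.weight (bar : Act → Rate → Rate) (c : Cls Act Key) : ℝ :=
  c.rateProd (fun _ l => l) / c.rateProd bar

lemma Cls.rateProd_pos (f : Act → Rate → Rate) (c : Cls Act Key) : 0 < c.rateProd f := by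
  induction c using Quotient.inductionOn with
  | h R => exact R.1.rateProd_pos f

lemma Cls.weight_pos (c : Cls Act Key) : 0 < c.weight bar :=
  div_pos (c.rateProd_pos _) (c.rateProd_pos _)

/-- There is exactly one kind of transition between two classes: forward transitions increase the
executed actions and multiply the product of forward rates, backward transitions decrease the
executed actions and divide the product of backward rates. -/
lemma Trans.cases {c c' : Cls Act Key} {l : Act × Rate} (h : Trans bar c l c') :
    (∃ n, c'.executed = c.executed + Multiset.replicate (n + 1) l.1 ∧
      c'.rateProd (fun _ l => l) = c.rateProd (fun _ l => l) * l.2) ∨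
    (∃ n, c.executed = c'.executed + Multiset.replicate (n + 1) l.1 ∧
      c.rateProd bar = c'.rateProd bar * l.2) := by
  obtain ⟨S, S', rfl, rfl, i, h | h⟩ := h
  · obtain ⟨n, hn⟩ := h.executed_eq
    exact Or.inl ⟨n, hn, h.rateProd_eq⟩
  · obtain ⟨r, hr⟩ := h.exists_fwd
    obtain ⟨n, hn⟩ := hr.executed_eq
    exact Or.inr ⟨n, hn, h.rateProd_eq⟩

lemma Trans.initial_eq {c c' : Cls Act Key} {l : Act × Rate} (h : Trans bar c l c') :
    c'.initial = c.initial := by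
  obtain ⟨S, S', rfl, rfl, i, h | h⟩ := h
  · exact h.initial_eq
  · obtain ⟨r, hr⟩ := h.exists_fwd
    exact hr.initial_eq.symm

/-- The number of executed prefixes fixes the direction, their multiset fixes the action, and
cancelling the positive product of forward or backward rates fixes the rate. -/
lemma Trans.label_unique {c c' : Cls Act Key} {l l' : Act × Rate} (h : Trans bar c l c')
    (h' : Trans bar c l' c') : l = l' := by
  obtain ⟨a, r⟩ := l
  obtain ⟨a', r'⟩ := l'
  have haux : ∀ {A : Multiset Act} {n m : ℕ}, A + Multiset.replicate (n + 1) a =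
      A + Multiset.replicate (m + 1) a' → a = a' := by
    intro A n m h
    have h1 := add_left_cancel h
    have h2 : a ∈ Multiset.replicate (m + 1) a' := by rw [← h1]; simp
    exact Multiset.eq_of_mem_replicate h2
  have hcontra : ∀ {A B : Multiset Act} {n m : ℕ} {b b' : Act},
      A = B + Multiset.replicate (n + 1) b → B = A + Multiset.replicate (m + 1) b' → False := by
    intro A B n m b b' h1 h2
    have h3 := congrArg Multiset.card h1
    have h4 := congrArg Multiset.card h2
    simp only [Multiset.card_add, Multiset.card_replicate] at h3 h4
    omega
  rcases h.cases with ⟨n, hn, hr⟩ | ⟨n, hn, hr⟩ <;>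
    rcases h'.cases with ⟨m, hm, hr'⟩ | ⟨m, hm, hr'⟩
  · exact Prod.ext (haux (hn.symm.trans hm)) (Subtype.ext
      (mul_left_cancel₀ (c.rateProd_pos _).ne' (hr.symm.trans hr')))
  · exact (hcontra hn hm).elim
  · exact (hcontra hn hm).elim
  · exact Prod.ext (haux (hn.symm.trans hm)) (Subtype.ext
      (mul_left_cancel₀ (c'.rateProd_pos _).ne' (hr.symm.trans hr')))

lemma Trans.ne {c c' : Cls Act Key} {l : Act × Rate} (h : Trans bar c l c') : c ≠ c' := by
  rintro rfl
  rcases h.cases with ⟨n, hn, -⟩ | ⟨n, hn, -⟩ <;>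
  · have := congrArg Multiset.card hn
    simp only [Multiset.card_add, Multiset.card_replicate] at this
    omega

/-- Every transition between classes has an inverse, and the two satisfy detailed balance. -/
lemma Trans.exists_symm {c c' : Cls Act Key} {l : Act × Rate} (h : Trans bar c l c') :
    ∃ l', Trans bar c' l' c ∧ c.weight bar * l.2 = c'.weight bar * l'.2 := by
  have haux : ∀ {S S' : RProc Act Key} {a : Act} {lam r : Rate} {i : Key},
      Fwd S.1 a lam i S'.1 → Bwd bar S'.1 a r i S.1 →
      Cls.weight bar (Quotient.mk _ S) * lam = Cls.weight bar (Quotient.mk _ S') * r := by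
    intro S S' a lam r i hf hb
    have h1 := hf.rateProd_eq
    have h2 := hb.rateProd_eq
    have h3 := S.1.rateProd_pos bar
    have h4 := r.2
    change S.1.rateProd _ / S.1.rateProd bar * _ = S'.1.rateProd _ / S'.1.rateProd bar * _
    rw [h1, h2]
    field_simp
  obtain ⟨S, S', rfl, rfl, i, h | h⟩ := h
  · obtain ⟨r, hr⟩ := h.exists_bwd bar
    exact ⟨(l.1, r), ⟨S', S, rfl, rfl, i, Or.inr hr⟩, haux h hr⟩
  · obtain ⟨r, hr⟩ := h.exists_fwd
    exact ⟨(l.1, r), ⟨S', S, rfl, rfl, i, Or.inl hr⟩, (haux hr h).symm⟩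

/-- Up to a renaming of keys, the keys of a process can be taken from a given sufficiently large
finite set. -/
lemma exists_keys_subset (F : Finset Key) (R : RProc Act Key)
    (hF : R.1.numPrefixes ≤ F.card) :
    ∃ R' : RProc Act Key, Quotient.mk (keyEquiv Act Key) R' = Quotient.mk _ R ∧
      R'.1.keys ⊆ F := by
  classical
  induction hn : (R.1.keys \ F).ncard using Nat.strong_induction_on generalizing R with
  | _ n ih =>
    by_cases hsub : R.1.keys ⊆ F
    · exact ⟨R, rfl, hsub⟩
    obtain ⟨i, hi, hiF⟩ := Set.not_subset.1 hsub
    have hfin := R.1.finite_keys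
    -- Pigeonhole: otherwise the keys would contain all of `F` and also `i`, exceeding the number of
    -- prefixes. Renaming `i` to `j` then leaves fewer keys outside `F`.
    obtain ⟨j, hjF, hj⟩ : ∃ j ∈ (F : Set Key), j ∉ R.1.keys := by
      by_contra! hcon
      have h1 := Set.ncard_lt_ncard (Set.ssubset_iff_of_subset hcon |>.2 ⟨i, hi, hiF⟩) hfin
      rw [Set.ncard_coe_finset] at h1
      exact absurd ((R.1.ncard_keys_le).trans hF) (not_le.2 h1)
    let R₁ : RProc Act Key := ⟨R.1.rekey i j, R.2.rekey hj⟩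
    have hclass : Quotient.mk (keyEquiv Act Key) R = Quotient.mk _ R₁ :=
      Quotient.sound (Relation.EqvGen.rel _ _ ⟨i, j, hj, rfl⟩)
    have hlt : (R₁.1.keys \ F).ncard < n := by
      rw [← hn]
      refine Set.ncard_lt_ncard ?_ (hfin.subset Set.sdiff_subset)
      refine (Set.ssubset_iff_of_subset ?_).2 ⟨i, ⟨hi, hiF⟩, ?_⟩
      · rintro k ⟨hk, hkF⟩
        rw [Proc.keys_rekey] at hk
        obtain ⟨l, hl, rfl⟩ := hk
        dsimp only at hkF ⊢
        split_ifs at hkF ⊢ with hli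
        · exact absurd hjF hkF
        · exact ⟨hl, hkF⟩
      · rintro ⟨hk, -⟩
        rw [Proc.keys_rekey] at hk
        obtain ⟨l, hl, hli⟩ := hk
        dsimp only at hli
        split_ifs at hli with h
        · exact hiF (hli ▸ hjF)
        · exact h hli
    have hnum : R₁.1.numPrefixes ≤ F.card := by
      rwa [← Proc.numPrefixes_initial, Proc.initial_rekey, Proc.numPrefixes_initial]
    obtain ⟨R', hR', hk⟩ := ih _ hlt R₁ hnum rfl
    exact ⟨R', hR'.trans hclass.symm, hk⟩

lemma finite_cls_initial_eq [Infinite Key] (P : Proc Act Key) :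
    {c : Cls Act Key | c.initial = P}.Finite := by
  obtain ⟨F, hF⟩ := Infinite.exists_subset_card_eq Key P.numPrefixes
  have hfin : {R : RProc Act Key | R.1.initial = P ∧ R.1.keys ⊆ F}.Finite :=
    (Proc.finite_initial_eq (F : Set Key) F.finite_toSet P).preimage Subtype.val_injective.injOn
  refine (hfin.image (Quotient.mk (keyEquiv Act Key))).subset fun c hc => ?_
  induction c using Quotient.inductionOn with
  | h R =>
    have hR : R.1.initial = P := hc
    obtain ⟨R', hR', hk⟩ := exists_keys_subset F R
      (by rw [hF, ← hR, Proc.numPrefixes_initial])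
    refine ⟨R', ⟨?_, hk⟩, hR'⟩
    rw [← hR]
    exact congrArg Cls.initial hR'

instance State.finite [Infinite Key] (R : RProc Act Key) : Finite (State bar R) := by
  refine ((finite_cls_initial_eq R.1.initial).subset fun c hc => ?_).to_subtype
  change c.initial = R.1.initial
  have hc' : Relation.ReflTransGen (fun d d' => ∃ l, Trans bar d l d') (Quotient.mk _ R) c := hc
  clear hc
  induction hc' with
  | refl => rfl
  | tail _ hbc ih => exact hbc.choose_spec.initial_eq.trans ih

lemma rate_eq {R : RProc Act Key} {s s' : State bar R} {l : Act × Rate}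
    (h : Trans bar s.1 l s'.1) : rate bar R s s' = l.2 := by
  have hset : {l : Act × Rate | Trans bar s.1 l s'.1} = {l} :=
    Set.eq_singleton_iff_unique_mem.2 ⟨h, fun l' h' => Trans.label_unique h' h⟩
  rw [rate, hset, finsum_mem_singleton]

lemma rate_eq_zero {R : RProc Act Key} {s s' : State bar R}
    (h : ∀ l, ¬ Trans bar s.1 l s'.1) : rate bar R s s' = 0 := by
  rw [rate, Set.eq_empty_of_forall_notMem (s := {l | Trans bar s.1 l s'.1}) h,
    finsum_mem_empty]

lemma rate_nonneg {R : RProc Act Key} (s s' : State bar R) : 0 ≤ rate bar R s s' :=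
  finsum_nonneg fun l => finsum_nonneg fun _ => l.2.2.le

lemma rate_detailed_balance {R : RProc Act Key} (s s' : State bar R) :
    s.1.weight bar * rate bar R s s' = s'.1.weight bar * rate bar R s' s := by
  by_cases h : ∃ l, Trans bar s.1 l s'.1
  · obtain ⟨l, hl⟩ := h
    obtain ⟨l', hl', heq⟩ := hl.exists_symm
    rw [rate_eq hl, rate_eq hl', heq]
  · have h' : ∀ l, ¬ Trans bar s'.1 l s.1 := fun l hl =>
      h (hl.exists_symm.imp fun _ h => h.1)
    rw [rate_eq_zero (not_exists.1 h), rate_eq_zero h', mul_zero, mul_zero]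

/-- Since transitions are invertible, each state is joined in both directions to the class of `R`.
-/
lemma state_connected {R : RProc Act Key} (s s' : State bar R) :
    Relation.ReflTransGen (fun a b => a ≠ b ∧ 0 < rate bar R a b) s s' := by
  have hstep : ∀ {a b : State bar R} {l : Act × Rate}, Trans bar a.1 l b.1 →
      a ≠ b ∧ 0 < rate bar R a b := fun {a b l} h =>
    ⟨fun hab => h.ne (congrArg Subtype.val hab), by rw [rate_eq h]; exact l.2.2⟩
  have hbase : ∀ (c : Cls Act Key) (hc : Relation.ReflTransGen (fun d d' => ∃ l, Trans bar d l d')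
      (Quotient.mk _ R) c),
      Relation.ReflTransGen (fun a b => a ≠ b ∧ 0 < rate bar R a b)
        (⟨Quotient.mk _ R, .refl⟩ : State bar R) ⟨c, hc⟩ ∧
      Relation.ReflTransGen (fun a b => a ≠ b ∧ 0 < rate bar R a b)
        (⟨c, hc⟩ : State bar R) ⟨Quotient.mk _ R, .refl⟩ := by
    intro c hc
    induction hc with
    | refl => exact ⟨.refl, .refl⟩
    | @tail b c hb hbc ih =>
      obtain ⟨l, hl⟩ := hbc
      obtain ⟨l', hl', -⟩ := hl.exists_symm
      exact ⟨ih.1.tail (hstep (a := ⟨b, hb⟩) hl), ih.2.head (hstep (b := ⟨b, hb⟩) hl')⟩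
  exact (hbase s.1 s.2).2.trans (hbase s'.1 s'.2).1

end Classes

end RMPC

theorem mainTheorem4 {Act : Type u} {Key : Type v} [Infinite Key]
    (bar : Act → RMPC.Rate → RMPC.Rate) (R : RMPC.RProc Act Key) (hR : R.1.ParOutermost) :
    ∃ _ : Fintype (RMPC.State bar R), RMPC.TimeReversible.{max u v, w} (RMPC.rate bar R) := by
  have : Nonempty (RMPC.State bar R) := ⟨⟨Quotient.mk _ R, .refl⟩⟩
  have := Fintype.ofFinite (RMPC.State bar R)
  exact ⟨this, RMPC.TimeReversible.of_detailed_balance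
    (w := fun s => s.1.weight bar) RMPC.rate_nonneg (fun s => s.1.weight_pos)
    (fun s s' _ => RMPC.rate_detailed_balance s s') RMPC.state_connected⟩
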